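/- Throughout, a monoid is a commutative cancellative semigroup with unit element. For a monoid $H$ and $a\in H$, let $\mathsf L(a)\subset\mathbb N_0$ be the set of all $k$ such that $aH^\times$ is a product of $k$ atoms of the reduced monoid $H_{\rm red}=\{bH^\times \mid b\in H\}$ (so $\mathsf L(a)=\{0\}$ for $a\in H^\times$). $H$ is atomic if $\mathsf L(a)\neq\emptyset$ for all $a\in H$, and half-factorial if $|\mathsf L(a)|=1$ for all $a\in H$. The elasticity of $a$ is $\rho(a)=\sup\{m/n \mid m,n\in\mathsf L(a)\}$, with $\rho(a)=1$ if $\mathsf L(a)=\{0\}$; the elasticity of $H$ is $\rho(H)=\sup\{\rho(a)\mid a\in H\}$, and it is accepted if $\rho(a)=\rho(H)$ for some $a\in H$. For $\delta\in\mathbb N$, $M\in\mathbb N_0$ and $\{0,\delta\}\subset\mathcal D\subset[0,\delta]$, a set $L\subset\mathbb Z$ is an almost arithmetical multiprogression (AAMP) with difference $\delta$, period $\mathcal D$ and bound $M$ if $L=y+(L'\cup L^*\cup L'')\subset y+\mathcal D+\delta\mathbb Z$, where $y\in\mathbb Z$, $L^*$ is finite and nonempty with $\min L^*=0$ and $L^*=(\mathcal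 D+\delta\mathbb Z)\cap[0,\max L^*]$, $L'\subset[-M,-1]$ and $L''\subset\max L^*+[1,M]$. The Structure Theorem for Sets of Lengths holds for $H$ if $H$ is atomic and there are $M\in\mathbb N_0$ and a finite nonempty set $\Delta^*\subset\mathbb N$ such that, for every $a\in H$, the set $\mathsf L(a)$ is an AAMP with some difference $\delta\in\Delta^*$ and bound $M$. **Corollary.** Let $H$ be a Krull monoid and let $\varphi\colon H\to\mathcal F(P)$ be a cofinal divisor homomorphism into a free abelian monoid with basis $P$ (that is, $\varphi(a)\mid\varphi(b)$ implies $a\mid b$ for all $a,b\in H$, and every element of $\mathcal F(P)$ divides $\varphi(u)$ for some $u\in H$). Suppose that the class group $\mathcal C(\varphi)=\mathsf q(\mathcal F(P))/\mathsf q(\varphi(H))$, the quotient of the quotient group of $\mathcal F(P)$ by the subgroup generated by $\varphi(H)$, is infinite cyclic, and identify it with $\mathbb Z$. Let $G_P\subset\mathbb Z$ be the set of classes containing an element of $P$. Suppose that $1\in G_P$ and that the set of negative elements of $G_P$ is $\{-d,-1\}$ for some $d\in\mathbb N$, $d\geq 1$. Suppose further that the Structure Theorem for Sets of Lengths holds for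 $H$. Then exactly one of the following two statements holds: (a) $H$ is half-factorial or $G_P$ is finite. (b) $\rho(H)=d$ and the elasticity of $H$ is not accepted. -/

import Mathlib

open scoped ENNReal

namespace KrullLengths

universe u v

/-! ### Factorizations and sets of lengths

Monoids are commutative and cancellative. The reduced monoid `H_red = {aH^× | a ∈ H}` is
`Associates H`. -/

section Lengths

variable (H : Type u) [CancelCommMonoid H]

/-- The factorization monoid `Z(H)`: the free abelian monoid on the atoms of `H_red`, whose
elements are finite multisets of atoms. -/
abbrev Factorization : Type u := Multiset {x : Associates H // Irreducible x}

variable {H}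

/-- The factorization homomorphism `π : Z(H) → H_red`. -/
def factorProd (z : Factorization H) : Associates H := (z.map Subtype.val).prod

/-- The set `Z(a)` of factorizations of `a`. -/
def factorizations (a : H) : Set (Factorization H) := {z | factorProd z = Associates.mk a}

/-- The set of lengths `L(a)` of `a`. -/
def lengthSet (a : H) : Set ℕ := {n | ∃ z ∈ factorizations a, Multiset.card z = n}

variable (H)

/-- Every element has a factorization. -/
def IsAtomic : Prop := ∀ a : H, (factorizations a).Nonempty

/-- `|L(a)| = 1` for all `a`. -/
def IsHalfFactorial : Prop := ∀ a : H, (lengthSet a).encard = 1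

open Classical in
/-- The elasticity of a set of lengths: `1` for `{0}`, and `sup {m / n | m, n ∈ L}` for a nonempty
set `L` of positive integers. -/
noncomputable def setElasticity (L : Set ℕ) : ℝ≥0∞ :=
  if L = {0} then 1 else ⨆ m ∈ L, ⨆ n ∈ L, (m : ℝ≥0∞) / (n : ℝ≥0∞)

variable {H} in
/-- The elasticity `ρ(a)` of an element. -/
noncomputable def elementElasticity (a : H) : ℝ≥0∞ := setElasticity (lengthSet a)

/-- The elasticity `ρ(H)` of a monoid. -/
noncomputable def elasticity : ℝ≥0∞ := ⨆ a : H, elementElasticity a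

/-- The elasticity of `H` is accepted: it is attained at some element. -/
def HasAcceptedElasticity : Prop := ∃ a : H, elementElasticity a = elasticity H

end Lengths

/-! ### Almost arithmetical multiprogressions and the Structure Theorem -/

/-- The set `D + dℤ`. -/
def periodicSet (D : Set ℤ) (d : ℕ) : Set ℤ := {x | ∃ r ∈ D, ∃ k : ℤ, x = r + (d : ℤ) * k}

/-- `L` is an almost arithmetical multiprogression with difference `d`, period `D` and bound `M`:
`L = y + (L' ∪ L* ∪ L'') ⊆ y + D + dℤ`, with central part `L* = (D + dℤ) ∩ [0, max L*]`,
initial part `L' ⊆ [-M, -1]` and end part `L'' ⊆ max L* + [1, M]`. -/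
def IsAAMP (L : Set ℤ) (d : ℕ) (D : Set ℤ) (M : ℕ) : Prop :=
  0 < d ∧ ({0, (d : ℤ)} : Set ℤ) ⊆ D ∧ D ⊆ Set.Icc 0 (d : ℤ) ∧
    ∃ (y m : ℤ) (L₁ Lc L₂ : Set ℤ),
      L = (fun x => y + x) '' (L₁ ∪ Lc ∪ L₂) ∧
      L ⊆ (fun x => y + x) '' periodicSet D d ∧
      Lc.Finite ∧ IsLeast Lc 0 ∧ IsGreatest Lc m ∧
      Lc = periodicSet D d ∩ Set.Icc 0 m ∧
      L₁ ⊆ Set.Icc (-(M : ℤ)) (-1) ∧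
      L₂ ⊆ Set.Icc (m + 1) (m + (M : ℤ))

/-- The Structure Theorem for Sets of Lengths holds for `H`: `H` is atomic, and there are a bound
`M` and a finite nonempty set `Δ` of positive integers such that every set of lengths is an almost
arithmetical multiprogression with bound `M` and some difference in `Δ`. -/
def StructureTheoremHolds (H : Type u) [CancelCommMonoid H] : Prop :=
  IsAtomic H ∧
    ∃ (M : ℕ) (Δ : Finset ℕ), Δ.Nonempty ∧ (∀ d ∈ Δ, 0 < d) ∧
      ∀ a : H, ∃ d ∈ Δ, ∃ D : Set ℤ, IsAAMP ((fun n : ℕ => (n : ℤ)) '' lengthSet a) d D M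

/-! ### Divisor homomorphisms, Krull monoids and class groups -/

/-- The free abelian monoid `F(P)` with basis `P`, written multiplicatively. -/
abbrev FreeAbMonoid (P : Type v) : Type v := Multiplicative (P →₀ ℕ)

/-- The basis element `p` of `F(P)`. -/
noncomputable def prime {P : Type v} (p : P) : FreeAbMonoid P :=
  Multiplicative.ofAdd (Finsupp.single p 1)

/-- `φ(a) ∣ φ(b)` implies `a ∣ b`. -/
def IsDivisorHom {H : Type u} {D : Type v} [CommMonoid H] [CommMonoid D] (φ : H →* D) : Prop :=
  ∀ a b : H, φ a ∣ φ b → a ∣ b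

/-- Every element of `D` divides some `φ(u)`. -/
def IsCofinal {H : Type u} {D : Type v} [CommMonoid H] [CommMonoid D] (φ : H →* D) : Prop :=
  ∀ a : D, ∃ h : H, a ∣ φ h

/-- `H` is a Krull monoid: `H_red` is (isomorphic to) a saturated submonoid of a free abelian
monoid. -/
def IsKrullMonoid (H : Type u) [CancelCommMonoid H] : Prop :=
  ∃ (P : Type u) (ψ : Associates H →* FreeAbMonoid P), Function.Injective ψ ∧ IsDivisorHom ψ

/-- The subgroup `q(φ(H))` of the quotient group `q(D)`, generated by `φ(H)`. -/
def imageSubgroup {H : Type u} {D : Type v} [CommMonoid H] [CommMonoid D] (φ : H →* D) :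
    Subgroup (Algebra.GrothendieckGroup D) :=
  Subgroup.closure (Set.range fun h : H => Algebra.GrothendieckGroup.of (φ h))

/-- The class group `C(φ) = q(D) / q(φ(H))` (written multiplicatively). -/
abbrev DivisorClassGroup {H : Type u} {D : Type v} [CommMonoid H] [CommMonoid D] (φ : H →* D) :
    Type v :=
  Algebra.GrothendieckGroup D ⧸ imageSubgroup φ

/-- The class `[a] ∈ C(φ)` of `a ∈ D`. -/
def divisorClass {H : Type u} {D : Type v} [CommMonoid H] [CommMonoid D] (φ : H →* D) (a : D) :
    DivisorClassGroup φ :=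
  QuotientGroup.mk (Algebra.GrothendieckGroup.of a)

/-- The set `G_P` of classes containing prime divisors, as a subset of `ℤ` under an identification
`e` of the class group with `ℤ`. -/
def primeClasses {H : Type u} {P : Type v} [CommMonoid H] (φ : H →* FreeAbMonoid P)
    (e : DivisorClassGroup φ ≃* Multiplicative ℤ) : Set ℤ :=
  Set.range fun p : P => Multiplicative.toAdd (e (divisorClass φ (prime p)))

end KrullLengths

open scoped ENNReal

namespace KrullLengths

universe u v

/-! The monoid `H_red` is identified with the zero-sum sequences over `P`, each prime carrying its
class in `ℤ`; atoms become minimal zero-sum sequences `U` (`irreducible_iff_isMinimalZeroSum`,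
`mem_lengthSet_iff`). Write `a`, `b`, `n` for the numbers of terms that are nonnegative, equal to
`-1`, and nonnegative but not divisible by `d`. These counts are additive, so they agree for all
factorizations of one element.

If `a ≥ 2`, no nonempty proper part of the nonnegative terms has a sum congruent mod `d` to one of
`0, …, b`, since it could be completed to a zero-sum sequence by terms `-1` and `-d`
(`not_congruent`). Hence the residues of the proper prefix sums are distinct and avoid `0, …, b`, so
`a + b ≤ d` (`nonnegCount_add_le`), and `n = a`.

For `d = 1` this forces `a = 1` for every atom, so `H` is half-factorial. For `d ≥ 2` it yields one
inequality on `n - b` from each side; compared for two factorizations of the same element, they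
bound the ratio of the lengths by `d(C + d - 1)/(C + d) < d`, where `C` bounds `b` on the atoms
involved (`mul_card_le`). Every single element therefore has elasticity below `d`. If `G_P` is
finite, `C` is uniform and `ρ(H) < d`. If `G_P` is infinite, it is unbounded above, and a large
class gives lengths `kd + 1` and `k + 1` of one element (`exists_sum_eq_sum`), so `ρ(H) = d` is not
accepted. -/

/-! ### Zero-sum sequences -/

section ZeroSum

variable {P : Type*} (w : P → ℤ)

/-- The sum of the sequence `S`, where `p` has the value `w p`. -/
def weight (S : Multiset P) : ℤ := (S.map w).sum

/-- `U` is a minimal zero-sum sequence. -/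
structure IsMinimalZeroSum (U : Multiset P) : Prop where
  ne_zero : U ≠ 0
  weight_eq : weight w U = 0
  eq_or_eq : ∀ T ≤ U, weight w T = 0 → T = 0 ∨ T = U

/-- The number of terms with nonnegative value. -/
def nonnegCount (U : Multiset P) : ℕ := U.countP fun p => 0 ≤ w p

/-- The number of terms with value `-1`. -/
def negOneCount (U : Multiset P) : ℕ := U.countP fun p => w p = -1

/-- The number of terms with nonnegative value not divisible by `d`. -/
def nondivCount (d : ℕ) (U : Multiset P) : ℕ := U.countP fun p => 0 ≤ w p ∧ ¬ (d : ℤ) ∣ w p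

variable {w}

@[simp] lemma weight_zero : weight w 0 = 0 := by simp [weight]

@[simp] lemma weight_add (S T : Multiset P) : weight w (S + T) = weight w S + weight w T := by
  simp [weight]

@[simp] lemma weight_singleton (p : P) : weight w {p} = w p := by simp [weight]

@[simp] lemma weight_nsmul (n : ℕ) (S : Multiset P) : weight w (n • S) = n * weight w S := by
  simp [weight, Multiset.map_nsmul, Multiset.sum_nsmul]

lemma weight_eq_card_mul {S : Multiset P} {c : ℤ} (h : ∀ p ∈ S, w p = c) :
    weight w S = S.card * c := by
  rw [weight, Multiset.map_congr rfl h, Multiset.map_const', Multiset.sum_replicate, nsmul_eq_mul]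

lemma weight_nonneg {S : Multiset P} (h : ∀ p ∈ S, 0 ≤ w p) : 0 ≤ weight w S :=
  Multiset.sum_nonneg (by simpa using h)

lemma exists_le_card_eq {α : Type*} {S : Multiset α} {n : ℕ} (h : n ≤ S.card) :
    ∃ T ≤ S, T.card = n := by
  induction S using Quotient.inductionOn with
  | h l => exact ⟨(l.take n : List α), (List.take_sublist n l).subperm, by simpa using h⟩

lemma filter_split (U : Multiset P) :
    U.filter (fun p => 0 ≤ w p) + (U.filter (fun p => w p = -1) +
      U.filter (fun p => w p < 0 ∧ w p ≠ -1)) = U := by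
  have h := Multiset.filter_add_not (fun p => w p = -1) (U.filter fun p => ¬ 0 ≤ w p)
  rw [Multiset.filter_filter, Multiset.filter_filter] at h
  conv_rhs => rw [← Multiset.filter_add_not (fun p => 0 ≤ w p) U, ← h]
  congr 2
  · exact Multiset.filter_congr fun p _ => by omega
  · exact Multiset.filter_congr fun p _ => by omega

/-! ### Minimal zero-sum sequences whose only negative values are `-d` and `-1`. -/

section Atoms

variable {d : ℕ} (hw : ∀ p, w p = -(d : ℤ) ∨ w p = -1 ∨ 0 ≤ w p)
include hw

lemma weight_filter_eq {U : Multiset P} (hU : weight w U = 0) :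
    weight w (U.filter fun p => 0 ≤ w p) =
      negOneCount w U + (U.filter (fun p => w p < 0 ∧ w p ≠ -1)).card * d := by
  have h := congrArg (weight w) (filter_split (w := w) U)
  rw [weight_add, weight_add, hU,
    weight_eq_card_mul (S := U.filter (fun p => w p = -1)) (c := -1) (by simp),
    weight_eq_card_mul (S := U.filter (fun p => w p < 0 ∧ w p ≠ -1)) (c := -(d : ℤ))] at h
  · rw [negOneCount, Multiset.countP_eq_card_filter]
    linarith
  · intro p hp
    have := (Multiset.mem_filter.1 hp).2
    have := hw p
    omega

/-- Otherwise `T` could be balanced by some of the terms `-1` and `-d` of `U`, giving a zero-sum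
subsequence that is neither empty nor all of `U`. -/
lemma IsMinimalZeroSum.not_congruent {U : Multiset P} (hU : IsMinimalZeroSum w U)
    {T : Multiset P} (hTA : T ≤ U.filter fun p => 0 ≤ w p) (hT : T ≠ 0)
    (hT' : T ≠ U.filter fun p => 0 ≤ w p) {r : ℕ} (hr : r ≤ negOneCount w U) (q : ℤ) :
    weight w T ≠ r + d * q := by
  intro hq
  have hA := weight_filter_eq hw hU.weight_eq
  set A := U.filter fun p => 0 ≤ w p with hAdef
  set M := U.filter fun p => w p = -1 with hM
  set N := U.filter fun p => w p < 0 ∧ w p ≠ -1 with hN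
  have hsplit : A + (M + N) = U := filter_split U
  have hMc : M.card = negOneCount w U := (Multiset.countP_eq_card_filter ..).symm
  obtain ⟨R, hR⟩ := Multiset.le_iff_exists_add.1 hTA
  have hA0 : ∀ p ∈ A, 0 ≤ w p := fun p hp => (Multiset.mem_filter.1 hp).2
  have hT0 : 0 ≤ weight w T := weight_nonneg fun p hp => hA0 p (Multiset.mem_of_le hTA hp)
  have hR0 : 0 ≤ weight w R := weight_nonneg fun p hp => hA0 p (by rw [hR]; simp [hp])
  have hTR : weight w T ≤ negOneCount w U + N.card * d := by
    rw [hR, weight_add] at hA; linarith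
  -- Take `q` terms `-d`, truncated to the range `0, …, N.card`, and fill up with terms `-1`. For `q
  -- < 0` the sum of `T` is at most `r`; for `q > N.card` the bound `hTR` leaves enough terms `-1`.
  obtain ⟨i, j, hi, hj, hij⟩ :
      ∃ i j : ℕ, i ≤ N.card ∧ j ≤ M.card ∧ weight w T = j + i * d := by
    rw [hMc]
    rcases lt_or_ge q 0 with hq0 | hq0
    · refine ⟨0, (weight w T).toNat, by omega, ?_, by simp [hT0]⟩
      have : (d : ℤ) * q ≤ 0 := mul_nonpos_of_nonneg_of_nonpos (by positivity) hq0.le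
      omega
    · rcases le_or_gt q N.card with hqN | hqN
      · refine ⟨q.toNat, r, by omega, hr, ?_⟩
        rw [hq, Int.toNat_of_nonneg hq0, mul_comm]
      · have : (N.card : ℤ) * d ≤ d * q := by
          rw [mul_comm]; exact mul_le_mul_of_nonneg_left hqN.le (by positivity)
        refine ⟨N.card, (weight w T - N.card * d).toNat, le_rfl, by omega, ?_⟩
        rw [Int.toNat_of_nonneg (by omega)]; ring
  obtain ⟨N', hN', rfl⟩ := exists_le_card_eq hi
  obtain ⟨M', hM', rfl⟩ := exists_le_card_eq hj
  have hMw : weight w M' = M'.card * (-1) :=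
    weight_eq_card_mul fun p hp => (Multiset.mem_filter.1 (Multiset.mem_of_le hM' hp)).2
  have hNw : weight w N' = N'.card * (-(d : ℤ)) := weight_eq_card_mul fun p hp => by
    have := (Multiset.mem_filter.1 (Multiset.mem_of_le hN' hp)).2
    have := hw p
    omega
  have hfil : ∀ V : Multiset P, V ≤ M + N → V.filter (fun p => 0 ≤ w p) = 0 := fun V hV =>
    Multiset.filter_eq_nil.2 fun p hp => by
      rcases Multiset.mem_add.1 (Multiset.mem_of_le hV hp) with h | h
      · have := (Multiset.mem_filter.1 h).2; omega
      · have := (Multiset.mem_filter.1 h).2; omega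
  rcases hU.eq_or_eq (T + (M' + N')) (hsplit ▸ add_le_add hTA (add_le_add hM' hN'))
    (by rw [weight_add, weight_add, hMw, hNw, hij]; ring) with h | h
  · exact hT (add_eq_zero.1 h).1
  · apply hT'
    rw [hAdef, ← h, Multiset.filter_add, hfil _ (add_le_add hM' hN'), add_zero,
      Multiset.filter_eq_self.2 fun p hp => hA0 p (Multiset.mem_of_le hTA hp)]

omit hw in
lemma IsMinimalZeroSum.nonnegCount_pos {U : Multiset P}
    (hU : IsMinimalZeroSum w U) : 0 < nonnegCount w U := by
  rw [nonnegCount, Multiset.countP_pos]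
  by_contra! h
  obtain ⟨p, hp⟩ := Multiset.exists_mem_of_ne_zero hU.ne_zero
  obtain ⟨V, rfl⟩ := Multiset.exists_cons_of_mem hp
  have hV : 0 ≤ weight (fun p => -w p) V := weight_nonneg fun q hq => by
    have := h q (by simp [hq]); omega
  have := hU.weight_eq
  have := h p hp
  simp only [weight, Multiset.map_cons, Multiset.sum_cons, Multiset.sum_map_neg] at *
  omega

/-- Consequences of minimality modulo `d` for a minimal zero-sum sequence with at least two
nonnegative terms. -/
lemma IsMinimalZeroSum.nonnegCount_add_le (hd : 0 < d) {U : Multiset P}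
    (hU : IsMinimalZeroSum w U) (h2 : 2 ≤ nonnegCount w U) :
    nonnegCount w U + negOneCount w U ≤ d := by
  obtain ⟨l, hl⟩ : ∃ l : List P, (l : Multiset P) = U.filter fun p => 0 ≤ w p :=
    Quot.exists_rep _
  have hlen : l.length = nonnegCount w U := by
    rw [nonnegCount, Multiset.countP_eq_card_filter, ← hl, Multiset.coe_card]
  have key : ∀ l' : List P, l'.Sublist l → 0 < l'.length → l'.length < l.length →
      ∀ r : ℕ, r ≤ negOneCount w U → ∀ q : ℤ, weight w (l' : Multiset P) ≠ r + d * q := by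
    intro l' hs h0 h1 r hr q
    refine hU.not_congruent hw (hl ▸ hs.subperm) ?_ ?_ hr q
    · rintro h
      have := congrArg Multiset.card h
      simp at this; simp [this] at h0
    · rintro h
      have := congrArg Multiset.card (h.trans hl.symm)
      simp at this; omega
  -- Pigeonhole on proper nonempty prefixes: their residues avoid `0, …, b`, where `b` is the number
  -- of terms `-1`.
  have hmaps : Set.MapsTo (fun i => (weight w ((l.take i : List P) : Multiset P) % d).toNat)
      (Finset.Ico 1 l.length : Finset ℕ) (Finset.Ico (negOneCount w U + 1) d : Finset ℕ) := by
    intro i hi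
    simp only [Finset.coe_Ico, Set.mem_Ico] at hi ⊢
    set s := weight w ((l.take i : List P) : Multiset P) with hs
    have hd0 : (d : ℤ) ≠ 0 := by omega
    have h1 := Int.emod_nonneg s hd0
    have h2 := Int.emod_lt_of_pos s (by omega : (0 : ℤ) < d)
    refine ⟨?_, by omega⟩
    by_contra! hlt
    refine key (l.take i) (List.take_sublist _ _) (by simp; omega) (by simp; omega)
      (s % d).toNat (by omega) (s / d) ?_
    rw [Int.toNat_of_nonneg h1, Int.emod_add_mul_ediv]
  -- Two prefixes with equal residues differ by a block whose sum is divisible by `d`, the excluded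
  -- case `r = 0`.
  have hinj : Set.InjOn (fun i => (weight w ((l.take i : List P) : Multiset P) % d).toNat)
      (Finset.Ico 1 l.length : Finset ℕ) := by
    have aux : ∀ i j, 1 ≤ i → i < j → j < l.length →
        (weight w ((l.take i : List P) : Multiset P) % d).toNat ≠
          (weight w ((l.take j : List P) : Multiset P) % d).toNat := by
      intro i j hi hij hj h
      have hd0 : (d : ℤ) ≠ 0 := by omega
      have h1 := Int.emod_nonneg (weight w ((l.take i : List P) : Multiset P)) hd0
      have h2 := Int.emod_nonneg (weight w ((l.take j : List P) : Multiset P)) hd0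
      have h3 : weight w ((l.take i : List P) : Multiset P) % d =
        weight w ((l.take j : List P) : Multiset P) % d := by omega
      obtain ⟨q, hq⟩ := Int.ModEq.dvd h3
      have hsub : ((l.drop i).take (j - i)).Sublist l :=
        (List.take_sublist _ _).trans (List.drop_sublist _ _)
      refine key _ hsub (by simp; omega) (by simp; omega) 0 (Nat.zero_le _) q ?_
      have e : l.take j = l.take i ++ (l.drop i).take (j - i) := by
        rw [← List.take_add]; congr 1; omega
      rw [e, ← Multiset.coe_add, weight_add] at hq
      push_cast
      linarith
    intro i hi j hj h
    simp only [Finset.coe_Ico, Set.mem_Ico] at hi hj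
    rcases lt_trichotomy i j with hij | hij | hij
    · exact (aux i j hi.1 hij hj.2 h).elim
    · exact hij
    · exact (aux j i hj.1 hij hi.2 h.symm).elim
  have hcard := Finset.card_le_card_of_injOn _ hmaps hinj
  simp only [Nat.card_Ico] at hcard
  omega

lemma IsMinimalZeroSum.nonnegCount_le (hd : 0 < d) {U : Multiset P}
    (hU : IsMinimalZeroSum w U) : nonnegCount w U ≤ d := by
  rcases lt_or_ge (nonnegCount w U) 2 with h | h
  · omega
  · have := hU.nonnegCount_add_le hw hd h
    omega

omit hw in
lemma nondivCount_le (U : Multiset P) : nondivCount w d U ≤ nonnegCount w U := by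
  rw [nondivCount, nonnegCount, Multiset.countP_eq_card_filter, Multiset.countP_eq_card_filter]
  exact Multiset.card_le_card (Multiset.monotone_filter_right U fun p hp => hp.1)

/-- A single nonnegative term divisible by `d` would be a proper part with residue `0`. -/
lemma IsMinimalZeroSum.nondivCount_eq {U : Multiset P}
    (hU : IsMinimalZeroSum w U) (h2 : 2 ≤ nonnegCount w U) :
    nondivCount w d U = nonnegCount w U := by
  rw [nondivCount, nonnegCount]
  refine Multiset.countP_congr rfl fun p hp => ?_
  simp only [eq_iff_iff, and_iff_left_iff_imp]
  rintro hp0 ⟨q, hq⟩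
  refine hU.not_congruent hw (T := {p}) ?_ (by simp) ?_ (Nat.zero_le _) q (by simpa using hq)
  · simpa using ⟨hp, hp0⟩
  · intro h
    rw [nonnegCount, Multiset.countP_eq_card_filter, ← h] at h2
    simp at h2

lemma IsMinimalZeroSum.exists_filter_eq {U : Multiset P}
    (hU : IsMinimalZeroSum w U) (h1 : nonnegCount w U = 1) :
    ∃ p, U.filter (fun p => 0 ≤ w p) = {p} ∧
      w p = negOneCount w U + (U.filter (fun p => w p < 0 ∧ w p ≠ -1)).card * d := by
  rw [nonnegCount, Multiset.countP_eq_card_filter, Multiset.card_eq_one] at h1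
  obtain ⟨p, hp⟩ := h1
  have := weight_filter_eq hw hU.weight_eq
  rw [hp, weight_singleton] at this
  exact ⟨p, hp, this⟩

/-- With one nonnegative term, its residue mod `d` is that of the number of terms `-1`, so it is
divisible by `d` when there are none. With at least two, the left side is at most `d`, which the
last summand already covers. -/
lemma IsMinimalZeroSum.nondivCount_le_add (hd : 0 < d) {U : Multiset P}
    (hU : IsMinimalZeroSum w U) :
    (nondivCount w d U : ℤ) ≤ negOneCount w U + d * (nonnegCount w U - 1) := by
  have h0 := hU.nonnegCount_pos
  have hle := nondivCount_le (w := w) (d := d) U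
  rcases Nat.lt_or_ge (nonnegCount w U) 2 with h | h
  · have h1 : nonnegCount w U = 1 := by omega
    obtain ⟨p, hp, hwp⟩ := hU.exists_filter_eq hw h1
    rw [h1] at hle ⊢
    rcases Nat.eq_zero_or_pos (negOneCount w U) with hb | hb
    · have : nondivCount w d U = 0 := by
        rw [nondivCount, Multiset.countP_eq_zero]
        rintro q hq ⟨hq0, hqd⟩
        have : q ∈ U.filter (fun p => 0 ≤ w p) := Multiset.mem_filter.2 ⟨hq, hq0⟩
        rw [hp, Multiset.mem_singleton] at this
        subst this
        exact hqd (hwp ▸ by simp [hb])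
      rw [this]; simp
    · push_cast; omega
  · have h1 := hU.nonnegCount_add_le hw hd h
    have : (d : ℤ) * 1 ≤ d * (nonnegCount w U - 1) :=
      mul_le_mul_of_nonneg_left (by omega) (by positivity)
    omega

/-- If there are `d` nonnegative terms, then none equals `-1` and none of the `d` is divisible by
`d`: equality holds. Otherwise the deficit is at least `1` and the left side is at most `-C`. -/
lemma IsMinimalZeroSum.le_nondivCount_sub (hd : 2 ≤ d) {U : Multiset P}
    (hU : IsMinimalZeroSum w U) {C : ℕ} (hC : negOneCount w U ≤ C) :
    (d : ℤ) - (C + d) * (d - nonnegCount w U) ≤ nondivCount w d U - negOneCount w U := by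
  have hle := hU.nonnegCount_le hw (by omega)
  rcases hle.eq_or_lt with h | h
  · have h1 := hU.nonnegCount_add_le hw (by omega) (h ▸ hd)
    rw [hU.nondivCount_eq hw (h ▸ hd), h]
    simp; omega
  · have : (C + d : ℤ) * 1 ≤ (C + d) * (d - nonnegCount w U) :=
      mul_le_mul_of_nonneg_left (by omega) (by positivity)
    omega

/-! ### Comparing factorizations through additive counts. -/

lemma card_le_sum_counts (hd : 0 < d) {Z : Multiset (Multiset P)}
    (hZ : ∀ U ∈ Z, IsMinimalZeroSum w U) :
    (nondivCount w d Z.sum : ℤ) ≤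
        negOneCount w Z.sum + d * (nonnegCount w Z.sum - Z.card) ∧
      Z.card ≤ nonnegCount w Z.sum := by
  induction Z using Multiset.induction with
  | empty => simp [nondivCount, negOneCount, nonnegCount]
  | cons U Z ih =>
    have h1 := ih fun V hV => hZ V (Multiset.mem_cons_of_mem hV)
    have hU := hZ U (Multiset.mem_cons_self U Z)
    have h2 := hU.nondivCount_le_add hw hd
    have h3 := hU.nonnegCount_pos
    simp only [nondivCount, negOneCount, nonnegCount, Multiset.sum_cons, Multiset.countP_add,
      Multiset.card_cons] at *
    push_cast
    refine ⟨by linarith, by omega⟩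

lemma le_sum_counts (hd : 2 ≤ d) {C : ℕ} {Z : Multiset (Multiset P)}
    (hZ : ∀ U ∈ Z, IsMinimalZeroSum w U) (hC : ∀ U ∈ Z, negOneCount w U ≤ C) :
    (d : ℤ) * Z.card - (C + d) * (d * Z.card - nonnegCount w Z.sum) ≤
      nondivCount w d Z.sum - negOneCount w Z.sum := by
  induction Z using Multiset.induction with
  | empty => simp [nondivCount, negOneCount, nonnegCount]
  | cons U Z ih =>
    have h1 := ih (fun V hV => hZ V (Multiset.mem_cons_of_mem hV))
      fun V hV => hC V (Multiset.mem_cons_of_mem hV)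
    have h2 := (hZ U (Multiset.mem_cons_self U Z)).le_nondivCount_sub hw hd
      (hC U (Multiset.mem_cons_self U Z))
    simp only [nondivCount, negOneCount, nonnegCount, Multiset.sum_cons, Multiset.countP_add,
      Multiset.card_cons] at *
    push_cast
    linarith

/-- Comparison of the lengths of two factorizations of a zero-sum sequence. -/
lemma mul_card_le (hd : 2 ≤ d) {C : ℕ} {Y Z : Multiset (Multiset P)}
    (hY : ∀ U ∈ Y, IsMinimalZeroSum w U) (hZ : ∀ U ∈ Z, IsMinimalZeroSum w U)
    (hC : ∀ U ∈ Z, negOneCount w U ≤ C) (hYZ : Y.sum = Z.sum) :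
    (C + d) * Y.card ≤ d * (C + d - 1) * Z.card := by
  obtain ⟨h1, h2⟩ := card_le_sum_counts hw (by omega) hY
  have h3 := le_sum_counts hw hd hZ hC
  rw [hYZ] at h1 h2
  have h4 : (d : ℤ) * (nonnegCount w Z.sum - Y.card) ≤
      (C + d) * (nonnegCount w Z.sum - Y.card) :=
    mul_le_mul_of_nonneg_right (by omega) (by omega)
  have h5 : ((C + d - 1 : ℕ) : ℤ) = C + d - 1 := by omega
  zify
  rw [h5]
  linarith

lemma card_eq_nonnegCount (hd : d = 1) {Z : Multiset (Multiset P)}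
    (hZ : ∀ U ∈ Z, IsMinimalZeroSum w U) : Z.card = nonnegCount w Z.sum := by
  induction Z using Multiset.induction with
  | empty => simp [nonnegCount]
  | cons U Z ih =>
    have h1 := ih fun V hV => hZ V (Multiset.mem_cons_of_mem hV)
    have hU := hZ U (Multiset.mem_cons_self U Z)
    have h2 := hU.nonnegCount_pos
    have h3 := hU.nonnegCount_le hw (by omega)
    simp only [nonnegCount, Multiset.sum_cons, Multiset.countP_add, Multiset.card_cons] at *
    omega

/-- The terms `-1` are limited by the single nonnegative value, or by `d` if there are several
nonnegative terms. -/
lemma IsMinimalZeroSum.negOneCount_le (hd : 0 < d) {U : Multiset P}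
    (hU : IsMinimalZeroSum w U) {B : ℕ} (hB : ∀ p, w p ≤ B) : negOneCount w U ≤ B + d := by
  rcases Nat.lt_or_ge (nonnegCount w U) 2 with h | h
  · obtain ⟨p, -, hwp⟩ := hU.exists_filter_eq hw (by have := hU.nonnegCount_pos; omega)
    have := hB p
    have : (0 : ℤ) ≤ (U.filter (fun p => w p < 0 ∧ w p ≠ -1)).card * d := by positivity
    omega
  · have := hU.nonnegCount_add_le hw hd h
    omega

/-! ### Explicit sequences with length ratio close to `d`. -/

omit hw in
/-- A sequence of sum zero with exactly one term of positive value, all others being negative,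
is minimal. -/
lemma isMinimalZeroSum_add_of_neg {p : P} {V : Multiset P} (hV : ∀ q ∈ V, w q < 0)
    (h : w p + weight w V = 0) : IsMinimalZeroSum w ({p} + V) := by
  have hneg : ∀ T ≤ V, 0 ≤ weight w T → T = 0 := by
    intro T hT h0
    by_contra hne
    obtain ⟨q, hq⟩ := Multiset.exists_mem_of_ne_zero hne
    obtain ⟨T', rfl⟩ := Multiset.exists_cons_of_mem hq
    have h1 : 0 ≤ weight (fun q => -w q) T' := weight_nonneg fun r hr => by
      have := hV r (Multiset.mem_of_le hT (by simp [hr])); omega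
    have h2 := hV q (Multiset.mem_of_le hT hq)
    simp only [weight, Multiset.map_cons, Multiset.sum_cons, Multiset.sum_map_neg] at *
    omega
  refine ⟨by simp, by rw [weight_add, weight_singleton, h], fun T hT hT0 => ?_⟩
  by_cases hp : p ∈ T
  · obtain ⟨T', rfl⟩ := Multiset.exists_cons_of_mem hp
    rw [Multiset.singleton_add] at hT ⊢
    obtain ⟨R, rfl⟩ := Multiset.le_iff_exists_add.1 ((Multiset.cons_le_cons_iff p).1 hT)
    right
    rw [hneg R (Multiset.le_add_left _ _), add_zero]
    rw [← Multiset.singleton_add, weight_add, weight_singleton] at hT0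
    rw [weight_add] at h
    omega
  · rw [Multiset.singleton_add] at hT
    left
    exact hneg T ((Multiset.le_cons_of_notMem hp).1 hT) hT0.ge

omit hw in
lemma isMinimalZeroSum_nsmul_add {p q : P} (hp : w p = 1) (hq : w q = -(d : ℤ)) :
    IsMinimalZeroSum w ({q} + d • {p}) := by
  have := isMinimalZeroSum_add_of_neg (w := fun r => -w r) (p := q) (V := d • {p})
    (fun r hr => by
      rw [Multiset.mem_nsmul] at hr
      simp [Multiset.mem_singleton.1 hr.2, hp]) (by simp [hp, hq])
  have hneg : ∀ T, weight (fun r => -w r) T = -weight w T := fun T => by simp [weight]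
  exact ⟨this.ne_zero, by simpa [hneg] using this.weight_eq,
    fun T hT h => this.eq_or_eq T hT (by simp [hneg, h])⟩

omit hw in
/-- Sequences with factorizations of lengths `k + 1` and `k * d + 1`. -/
lemma exists_sum_eq_sum (hd : 0 < d) {o m n g : P} (ho : w o = 1) (hm : w m = -1)
    (hn : w n = -(d : ℤ)) {k r : ℕ} (hg : w g = k * d + r) :
    ∃ Y Z : Multiset (Multiset P), (∀ U ∈ Y, IsMinimalZeroSum w U) ∧
      (∀ U ∈ Z, IsMinimalZeroSum w U) ∧ Y.sum = Z.sum ∧ Y.card = k * d + 1 ∧ Z.card = k + 1 := by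
  -- In the long factorization `g` absorbs the terms `-d`, so each `1` can pair with a `-1`; in the
  -- short one `g` absorbs all the `-1`, and each `-d` consumes `d` terms `1`.
  refine ⟨{{g} + (k • {n} + r • {m})} + (k * d) • {{o} + {m}},
    {{g} + (k * d + r) • {m}} + k • {{n} + d • {o}}, ?_, ?_, ?_, by simp [add_comm],
    by simp [add_comm]⟩
  · intro U hU
    rcases Multiset.mem_add.1 hU with hU | hU
    · rw [Multiset.mem_singleton.1 hU]
      refine isMinimalZeroSum_add_of_neg (fun q hq => ?_) (by simp [hn, hm, hg]; ring)
      rcases Multiset.mem_add.1 hq with hq | hq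
      · rw [Multiset.mem_singleton.1 (Multiset.mem_of_mem_nsmul hq), hn]; omega
      · rw [Multiset.mem_singleton.1 (Multiset.mem_of_mem_nsmul hq), hm]; omega
    · rw [Multiset.mem_singleton.1 (Multiset.mem_of_mem_nsmul hU)]
      exact isMinimalZeroSum_add_of_neg (fun q hq => by
        rw [Multiset.mem_singleton.1 hq, hm]; omega) (by simp [ho, hm])
  · intro U hU
    rcases Multiset.mem_add.1 hU with hU | hU
    · rw [Multiset.mem_singleton.1 hU]
      refine isMinimalZeroSum_add_of_neg (fun q hq => ?_) (by simp [hm, hg])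
      rw [Multiset.mem_singleton.1 (Multiset.mem_of_mem_nsmul hq), hm]; omega
    · rw [Multiset.mem_singleton.1 (Multiset.mem_of_mem_nsmul hU)]
      exact isMinimalZeroSum_nsmul_add ho hn
  · simp only [Multiset.sum_add, Multiset.sum_singleton, Multiset.sum_nsmul, nsmul_add, add_nsmul,
      mul_nsmul']
    abel

end Atoms

end ZeroSum

/-! ### Transfer of lengths to zero-sum sequences -/

section Transfer

variable {H : Type u} [CancelCommMonoid H] {P : Type v} (φ : H →* FreeAbMonoid P)

/-- The sequence over `P` which corresponds to `φ a`. -/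
noncomputable def primeSequence (a : H) : Multiset P :=
  Finsupp.toMultiset (Multiplicative.toAdd (φ a))

/-- The integer corresponding to the class of `p`. -/
noncomputable def classValue (e : DivisorClassGroup φ ≃* Multiplicative ℤ) (p : P) : ℤ :=
  Multiplicative.toAdd (e (divisorClass φ (prime p)))

variable {φ}

lemma divisorClass_mul (x y : FreeAbMonoid P) :
    divisorClass φ (x * y) = divisorClass φ x * divisorClass φ y := by
  simp [divisorClass]

lemma divisorClass_one : divisorClass φ (1 : FreeAbMonoid P) = 1 := by
  simp [divisorClass]

lemma weight_toMultiset (e : DivisorClassGroup φ ≃* Multiplicative ℤ) (x : P →₀ ℕ) :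
    weight (classValue φ e) (Finsupp.toMultiset x) =
      Multiplicative.toAdd (e (divisorClass φ (Multiplicative.ofAdd x))) := by
  induction x using Finsupp.induction_linear with
  | zero => simp [divisorClass_one]
  | add x y hx hy =>
    rw [map_add, weight_add, hx, hy, ofAdd_add, divisorClass_mul, map_mul, toAdd_mul]
  | single p n =>
    have h : (Multiplicative.ofAdd (Finsupp.single p n) : FreeAbMonoid P) = prime p ^ n := by
      rw [prime, ← ofAdd_nsmul, Finsupp.smul_single, smul_eq_mul, mul_one]
    rw [h, Finsupp.toMultiset_single, weight_nsmul, weight_singleton, divisorClass, map_pow,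
      QuotientGroup.mk_pow, map_pow, toAdd_pow, nsmul_eq_mul]
    rfl

lemma mem_imageSubgroup {x : Algebra.GrothendieckGroup (FreeAbMonoid P)}
    (hx : x ∈ imageSubgroup φ) : ∃ a b : H,
      x * Algebra.GrothendieckGroup.of (φ b) = Algebra.GrothendieckGroup.of (φ a) := by
  induction hx using Subgroup.closure_induction with
  | mem x hx =>
    obtain ⟨a, rfl⟩ := hx
    exact ⟨a, 1, by simp⟩
  | one => exact ⟨1, 1, by simp⟩
  | mul x y _ _ hx hy =>
    obtain ⟨a, b, h⟩ := hx
    obtain ⟨a', b', h'⟩ := hy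
    exact ⟨a * a', b * b', by rw [map_mul, map_mul, mul_mul_mul_comm, h, h', map_mul, map_mul]⟩
  | inv x _ hx =>
    obtain ⟨a, b, h⟩ := hx
    exact ⟨b, a, by rw [← h, inv_mul_cancel_left]⟩

/-- An element of trivial class is a quotient of two images under `φ`; the divisor property turns
this into division in `H`, and cancellation identifies the quotient. -/
lemma divisorClass_eq_one_iff (hdiv : IsDivisorHom φ) (x : FreeAbMonoid P) :
    divisorClass φ x = 1 ↔ ∃ a, φ a = x := by
  rw [divisorClass, QuotientGroup.eq_one_iff]
  constructor
  · intro h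
    obtain ⟨a, b, hab⟩ := mem_imageSubgroup h
    rw [← map_mul] at hab
    have hab := Algebra.GrothendieckGroup.of_injective hab
    obtain ⟨c, rfl⟩ := hdiv b a ⟨x, by rw [← hab, mul_comm]⟩
    refine ⟨c, ?_⟩
    rw [map_mul, mul_comm x] at hab
    exact (mul_left_cancel hab).symm
  · rintro ⟨a, rfl⟩
    exact Subgroup.subset_closure ⟨a, rfl⟩

lemma toMultiset_injective {α : Type*} :
    Function.Injective (Finsupp.toMultiset : (α →₀ ℕ) → Multiset α) := by
  classical
  exact Function.LeftInverse.injective Finsupp.toMultiset_toFinsupp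

lemma weight_eq_zero_iff (hdiv : IsDivisorHom φ) (e : DivisorClassGroup φ ≃* Multiplicative ℤ)
    (S : Multiset P) : weight (classValue φ e) S = 0 ↔ ∃ a, primeSequence φ a = S := by
  classical
  obtain ⟨x, rfl⟩ : ∃ x, Finsupp.toMultiset x = S := ⟨_, Multiset.toFinsupp_toMultiset S⟩
  rw [weight_toMultiset, toAdd_eq_zero, map_eq_one_iff e e.injective,
    divisorClass_eq_one_iff hdiv]
  refine exists_congr fun a => ?_
  rw [primeSequence, toMultiset_injective.eq_iff]
  rfl

@[simp] lemma primeSequence_one : primeSequence φ 1 = 0 := by simp [primeSequence]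

@[simp] lemma primeSequence_mul (a b : H) :
    primeSequence φ (a * b) = primeSequence φ a + primeSequence φ b := by
  simp [primeSequence]

lemma dvd_of_primeSequence_le (hdiv : IsDivisorHom φ) {a b : H}
    (h : primeSequence φ a ≤ primeSequence φ b) : a ∣ b := by
  classical
  obtain ⟨R, hR⟩ := Multiset.le_iff_exists_add.1 h
  obtain ⟨x, rfl⟩ : ∃ x, Finsupp.toMultiset x = R := ⟨_, Multiset.toFinsupp_toMultiset R⟩
  refine hdiv a b ⟨Multiplicative.ofAdd x, ?_⟩
  rw [primeSequence, primeSequence, ← map_add, toMultiset_injective.eq_iff] at hR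
  exact hR

lemma primeSequence_le_of_dvd {a b : H} (h : a ∣ b) : primeSequence φ a ≤ primeSequence φ b := by
  obtain ⟨c, rfl⟩ := h
  rw [primeSequence_mul]
  exact Multiset.le_add_right _ _

variable (φ) in
/-- The sequence over `P` which corresponds to an element of the reduced monoid. -/
noncomputable def reducedSequence : Associates H →* Multiplicative (Multiset P) where
  toFun := Quotient.lift (fun a => Multiplicative.ofAdd (primeSequence φ a)) fun _ _ hab =>
    congrArg Multiplicative.ofAdd (le_antisymm (primeSequence_le_of_dvd (Associated.dvd hab))
      (primeSequence_le_of_dvd (Associated.dvd hab.symm)))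
  map_one' := congrArg Multiplicative.ofAdd primeSequence_one
  map_mul' x y := Quotient.inductionOn₂ x y fun a b =>
    congrArg Multiplicative.ofAdd (primeSequence_mul a b)

lemma reducedSequence_mk (a : H) : (reducedSequence φ (Associates.mk a)).toAdd =
    primeSequence φ a := rfl

lemma reducedSequence_injective (hdiv : IsDivisorHom φ) :
    Function.Injective (reducedSequence φ) := by
  intro x y
  refine Quotient.inductionOn₂ x y fun a b h => ?_
  have h : primeSequence φ a = primeSequence φ b := h
  obtain ⟨c, rfl⟩ := dvd_of_primeSequence_le hdiv h.le
  obtain ⟨c', hc'⟩ := dvd_of_primeSequence_le hdiv h.ge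
  rw [mul_assoc, left_eq_mul] at hc'
  exact Associates.mk_eq_mk_iff_associated.2 ⟨Units.mkOfMulEqOne c c' hc', rfl⟩

/-- `reducedSequence` is injective with image exactly the zero-sum sequences, so a zero-sum
subsequence and its complement are the same as a product decomposition. -/
lemma irreducible_iff_isMinimalZeroSum (hdiv : IsDivisorHom φ)
    (e : DivisorClassGroup φ ≃* Multiplicative ℤ) (x : Associates H) :
    Irreducible x ↔ IsMinimalZeroSum (classValue φ e) (reducedSequence φ x).toAdd := by
  have hz := weight_eq_zero_iff hdiv e
  have hinj := reducedSequence_injective hdiv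
  have hsurj : ∀ S, weight (classValue φ e) S = 0 →
      ∃ y : Associates H, (reducedSequence φ y).toAdd = S := fun S hS => by
    obtain ⟨a, ha⟩ := (hz S).1 hS
    exact ⟨Associates.mk a, ha⟩
  have hw0 : ∀ y : Associates H, weight (classValue φ e) (reducedSequence φ y).toAdd = 0 :=
    fun y => Quotient.inductionOn y fun a => (hz _).2 ⟨a, rfl⟩
  have hzero : ∀ y : Associates H, (reducedSequence φ y).toAdd = 0 ↔ y = 1 := fun y => by
    rw [toAdd_eq_zero, map_eq_one_iff _ hinj]
  constructor
  · intro hx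
    refine ⟨fun h => hx.ne_one ((hzero x).1 h), hw0 x, fun T hT hT0 => ?_⟩
    obtain ⟨R, hR⟩ := Multiset.le_iff_exists_add.1 hT
    have hR0 : weight (classValue φ e) R = 0 := by
      have := hw0 x
      rwa [hR, weight_add, hT0, zero_add] at this
    obtain ⟨y, rfl⟩ := hsurj T hT0
    obtain ⟨z, rfl⟩ := hsurj R hR0
    have hxyz : x = y * z := hinj (by
      rw [map_mul]; exact hR)
    rcases hx.isUnit_or_isUnit hxyz with h | h
    · exact Or.inl ((hzero y).2 (Associates.isUnit_iff_eq_one y |>.1 h))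
    · right
      rw [hxyz, Associates.isUnit_iff_eq_one z |>.1 h, mul_one]
  · intro hx
    refine ⟨fun h => hx.ne_zero ((hzero x).2 (Associates.isUnit_iff_eq_one x |>.1 h)),
      fun y z hxyz => ?_⟩
    have hsum : (reducedSequence φ x).toAdd =
        (reducedSequence φ y).toAdd + (reducedSequence φ z).toAdd := by
      rw [hxyz, map_mul, toAdd_mul]
    rcases hx.eq_or_eq _ (hsum ▸ Multiset.le_add_right _ _) (hw0 y) with h | h
    · exact Or.inl ((Associates.isUnit_iff_eq_one y).2 ((hzero y).1 h))
    · right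
      rw [h, left_eq_add] at hsum
      exact (Associates.isUnit_iff_eq_one z).2 ((hzero z).1 hsum)

/-- Factorizations of `a` correspond to factorizations of its sequence into minimal zero-sum
sequences. -/
lemma mem_lengthSet_iff (hdiv : IsDivisorHom φ) (e : DivisorClassGroup φ ≃* Multiplicative ℤ)
    (a : H) (n : ℕ) : n ∈ lengthSet a ↔ ∃ Z : Multiset (Multiset P),
      (∀ U ∈ Z, IsMinimalZeroSum (classValue φ e) U) ∧ Z.sum = primeSequence φ a ∧
        Z.card = n := by
  have hirr := irreducible_iff_isMinimalZeroSum hdiv e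
  let f : {x : Associates H // Irreducible x} → Multiset P :=
    fun x => (reducedSequence φ x.1).toAdd
  have hsum : ∀ z : Factorization H, (z.map f).sum = (reducedSequence φ (factorProd z)).toAdd := by
    intro z
    induction z using Multiset.induction with
    | empty => simp [factorProd]
    | cons x z ih =>
      rw [Multiset.map_cons, Multiset.sum_cons, ih, factorProd, factorProd, Multiset.map_cons,
        Multiset.prod_cons, map_mul, toAdd_mul]
  have hlift : ∀ Z : Multiset (Multiset P), (∀ U ∈ Z, IsMinimalZeroSum (classValue φ e) U) →
      ∃ z : Factorization H, z.map f = Z := by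
    intro Z hZ
    induction Z using Multiset.induction with
    | empty => exact ⟨0, rfl⟩
    | cons U Z ih =>
      obtain ⟨z, hz⟩ := ih fun V hV => hZ V (Multiset.mem_cons_of_mem hV)
      have hU := hZ U (Multiset.mem_cons_self U Z)
      obtain ⟨b, hb⟩ := (weight_eq_zero_iff hdiv e U).1 hU.weight_eq
      rw [← hb, ← reducedSequence_mk, ← hirr] at hU
      exact ⟨⟨_, hU⟩ ::ₘ z, by rw [Multiset.map_cons, hz, ← hb]; rfl⟩
  have hmem : ∀ z : Factorization H, z ∈ factorizations a ↔ (z.map f).sum = primeSequence φ a :=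
    fun z => by
      rw [hsum, ← reducedSequence_mk, Multiplicative.toAdd.injective.eq_iff,
        (reducedSequence_injective hdiv).eq_iff]
      rfl
  constructor
  · rintro ⟨z, hz, rfl⟩
    refine ⟨z.map f, fun U hU => ?_, (hmem z).1 hz, Multiset.card_map _ _⟩
    obtain ⟨x, -, rfl⟩ := Multiset.mem_map.1 hU
    exact (hirr x.1).1 x.2
  · rintro ⟨Z, hZ, hs, rfl⟩
    obtain ⟨z, rfl⟩ := hlift Z hZ
    exact ⟨z, (hmem z).2 hs, (Multiset.card_map _ _).symm⟩

lemma lengthSet_one (hdiv : IsDivisorHom φ) (e : DivisorClassGroup φ ≃* Multiplicative ℤ) :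
    lengthSet (1 : H) = {0} := by
  ext n
  rw [mem_lengthSet_iff hdiv e, Set.mem_singleton_iff, primeSequence_one]
  constructor
  · rintro ⟨Z, hZ, hs, rfl⟩
    rw [Multiset.card_eq_zero]
    by_contra h
    obtain ⟨U, hU⟩ := Multiset.exists_mem_of_ne_zero h
    obtain ⟨Y, rfl⟩ := Multiset.exists_cons_of_mem hU
    rw [Multiset.sum_cons, add_eq_zero] at hs
    exact (hZ U hU).ne_zero hs.1
  · rintro rfl
    exact ⟨0, by simp⟩

end Transfer

/-! ### Elasticities -/

lemma setElasticity_le {L : Set ℕ} {κ : ℝ≥0∞} (h1 : 1 ≤ κ)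
    (h : ∀ m ∈ L, ∀ n ∈ L, (m : ℝ≥0∞) ≤ κ * n) : setElasticity L ≤ κ := by
  rw [setElasticity]
  split_ifs
  · exact h1
  · exact iSup₂_le fun m hm => iSup₂_le fun n hn => ENNReal.div_le_of_le_mul (h m hm n hn)

lemma le_setElasticity {L : Set ℕ} {m n : ℕ} (hm : m ∈ L) (hn : n ∈ L) (hm0 : m ≠ 0) :
    (m : ℝ≥0∞) / n ≤ setElasticity L := by
  rw [setElasticity, if_neg (by rintro rfl; exact hm0 hm)]
  exact le_iSup₂_of_le m hm (le_iSup₂_of_le n hn le_rfl)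

lemma IsHalfFactorial.elasticity_le {H : Type u} [CancelCommMonoid H] (h : IsHalfFactorial H) :
    elasticity H ≤ 1 := by
  refine iSup_le fun a => setElasticity_le le_rfl fun m hm n hn => ?_
  obtain ⟨l, hl⟩ := Set.encard_eq_one.1 (h a)
  rw [hl] at hm hn
  rw [Set.mem_singleton_iff.1 hm, Set.mem_singleton_iff.1 hn, one_mul]

/-! ### Bounds for the elasticity of `H`. -/

section Elasticity

variable {H : Type u} [CancelCommMonoid H] {P : Type v} {φ : H →* FreeAbMonoid P}
  (hdiv : IsDivisorHom φ) (e : DivisorClassGroup φ ≃* Multiplicative ℤ) {d : ℕ}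

/-- An upper bound smaller than `d` for elasticities. -/
noncomputable def elasticityBound (d C : ℕ) : ℝ≥0∞ := (d * (C + d - 1) : ℕ) / (C + d : ℕ)

lemma one_le_elasticityBound (hd : 2 ≤ d) (C : ℕ) : 1 ≤ elasticityBound d C := by
  rw [elasticityBound, ENNReal.le_div_iff_mul_le (Or.inl (by simp; omega)) (Or.inl (by simp)),
    one_mul, Nat.cast_le]
  calc C + d ≤ 2 * (C + d - 1) := by omega
    _ ≤ d * (C + d - 1) := Nat.mul_le_mul_right _ hd

lemma elasticityBound_lt (hd : 2 ≤ d) (C : ℕ) : elasticityBound d C < d := by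
  rw [elasticityBound, ENNReal.div_lt_iff (Or.inl (by simp; omega)) (Or.inl (by simp)),
    ← Nat.cast_mul, Nat.cast_lt]
  exact Nat.mul_lt_mul_of_pos_left (by omega) (by omega)

include hdiv e

lemma elementElasticity_le (hw : ∀ p, classValue φ e p = -(d : ℤ) ∨ classValue φ e p = -1 ∨
    0 ≤ classValue φ e p) (hd : 2 ≤ d) {C : ℕ} {a : H}
    (hC : ∀ U ≤ primeSequence φ a, IsMinimalZeroSum (classValue φ e) U →
      negOneCount (classValue φ e) U ≤ C) : elementElasticity a ≤ elasticityBound d C := by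
  refine setElasticity_le (one_le_elasticityBound hd C) fun m hm n hn => ?_
  obtain ⟨Y, hY, hYs, rfl⟩ := (mem_lengthSet_iff hdiv e a m).1 hm
  obtain ⟨Z, hZ, hZs, rfl⟩ := (mem_lengthSet_iff hdiv e a n).1 hn
  have h := mul_card_le hw hd hY hZ
    (fun U hU => hC U (hZs ▸ Multiset.single_le_sum (by simp) U hU) (hZ U hU))
    (hYs.trans hZs.symm)
  rw [elasticityBound, ← ENNReal.mul_div_right_comm,
    ENNReal.le_div_iff_mul_le (Or.inl (by simp; omega)) (Or.inl (by simp))]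
  rw [mul_comm] at h
  exact_mod_cast h

lemma isHalfFactorial_of_eq_one (hat : IsAtomic H) (hw : ∀ p, classValue φ e p = -(d : ℤ) ∨
    classValue φ e p = -1 ∨ 0 ≤ classValue φ e p) (hd : d = 1) : IsHalfFactorial H := by
  intro a
  rw [Set.encard_eq_one]
  refine ⟨nonnegCount (classValue φ e) (primeSequence φ a),
    Set.eq_singleton_iff_nonempty_unique_mem.2 ⟨?_, fun n hn => ?_⟩⟩
  · obtain ⟨z, hz⟩ := hat a
    exact ⟨_, z, hz, rfl⟩
  · obtain ⟨Z, hZ, hs, rfl⟩ := (mem_lengthSet_iff hdiv e a n).1 hn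
    rw [← hs, card_eq_nonnegCount hw hd hZ]

lemma IsHalfFactorial.hasAcceptedElasticity (h : IsHalfFactorial H) :
    HasAcceptedElasticity H := by
  have h1 : elementElasticity (1 : H) = 1 := by
    rw [elementElasticity, setElasticity, if_pos (lengthSet_one hdiv e)]
  exact ⟨1, le_antisymm (le_iSup (fun a : H => elementElasticity a) 1)
    (h1 ▸ h.elasticity_le)⟩

lemma le_elasticity (hd : 0 < d) {o m n : P} (ho : classValue φ e o = 1)
    (hm : classValue φ e m = -1) (hn : classValue φ e n = -(d : ℤ))
    (hinf : ∀ B : ℕ, ∃ g, (B : ℤ) < classValue φ e g) : (d : ℝ≥0∞) ≤ elasticity H := by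
  have key : ∀ K : ℕ, ∃ k : ℕ, K ≤ k ∧ ((k * d + 1 : ℕ) : ℝ≥0∞) ≤ elasticity H * (k + 1 : ℕ) := by
    intro K
    obtain ⟨g, hg⟩ := hinf (K * d)
    obtain ⟨v, hv⟩ := Int.eq_ofNat_of_zero_le ((Int.natCast_nonneg _).trans hg.le)
    refine ⟨v / d, (Nat.le_div_iff_mul_le hd).2 (by omega), ?_⟩
    have hg' : classValue φ e g = (v / d : ℕ) * d + (v % d : ℕ) := by
      rw [hv]; exact_mod_cast (Nat.div_add_mod' v d).symm
    obtain ⟨Y, Z, hY, hZ, hYZ, hYc, hZc⟩ := exists_sum_eq_sum hd ho hm hn hg'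
    have hw0 : weight (classValue φ e) Y.sum = 0 := by
      clear hYZ hYc
      induction Y using Multiset.induction with
      | empty => simp
      | cons U Y ih =>
        rw [Multiset.sum_cons, weight_add, (hY U (Multiset.mem_cons_self U Y)).weight_eq,
          ih fun V hV => hY V (Multiset.mem_cons_of_mem hV), add_zero]
    obtain ⟨a, ha⟩ := (weight_eq_zero_iff hdiv e _).1 hw0
    have h1 : v / d * d + 1 ∈ lengthSet a := (mem_lengthSet_iff hdiv e a _).2 ⟨Y, hY, ha.symm, hYc⟩
    have h2 : v / d + 1 ∈ lengthSet a :=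
      (mem_lengthSet_iff hdiv e a _).2 ⟨Z, hZ, hYZ.symm.trans ha.symm, hZc⟩
    have h3 := (le_setElasticity h1 h2 (by omega)).trans
      (le_iSup (fun a : H => elementElasticity a) a)
    rwa [ENNReal.div_le_iff (by simp) (by simp)] at h3
  by_contra! hlt
  have hr := ENNReal.ofReal_toReal hlt.ne_top
  set r := (elasticity H).toReal with hrdef
  have hrd : r < d := by
    have := (ENNReal.toReal_lt_toReal hlt.ne_top (by simp)).2 hlt
    simpa using this
  -- Beyond this threshold `k * (d - r) > r`, whereas `k * d + 1 ≤ r * (k + 1)` forces `k * (d - r)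
  -- ≤ r - 1`.
  obtain ⟨K, hK⟩ := exists_nat_gt (r / (d - r))
  obtain ⟨k, hKk, hk⟩ := key K
  have hk' : (k * d + 1 : ℝ) ≤ r * (k + 1) := by
    have := ENNReal.toReal_mono (ENNReal.mul_ne_top hlt.ne_top (by simp)) hk
    rw [ENNReal.toReal_mul, ENNReal.toReal_natCast, ENNReal.toReal_natCast, ← hrdef] at this
    exact_mod_cast this
  have hKk' : (K : ℝ) ≤ k := by exact_mod_cast hKk
  have h4 : r < k * (d - r) := (div_lt_iff₀ (sub_pos.2 hrd)).1 (hK.trans_le hKk')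
  linarith

end Elasticity

end KrullLengths

/-! ### The dichotomy. -/

theorem mainTheorem9 {H : Type*} [CancelCommMonoid H] {P : Type*}
    (hH : KrullLengths.IsKrullMonoid H)
    (φ : H →* KrullLengths.FreeAbMonoid P)
    (hdiv : KrullLengths.IsDivisorHom φ)
    (hcof : KrullLengths.IsCofinal φ)
    (e : KrullLengths.DivisorClassGroup φ ≃* Multiplicative ℤ)
    (d : ℕ) (hd : 0 < d)
    (hpos : (1 : ℤ) ∈ KrullLengths.primeClasses φ e)
    (hneg : KrullLengths.primeClasses φ e ∩ Set.Iio 0 = {-(d : ℤ), -1})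
    (hST : KrullLengths.StructureTheoremHolds H) :
    Xor
      (KrullLengths.IsHalfFactorial H ∨ (KrullLengths.primeClasses φ e).Finite)
      (KrullLengths.elasticity H = (d : ℝ≥0∞) ∧ ¬ KrullLengths.HasAcceptedElasticity H) := by
  open KrullLengths in
  have hrange : primeClasses φ e = Set.range (classValue φ e) := rfl
  have hw : ∀ p, classValue φ e p = -(d : ℤ) ∨ classValue φ e p = -1 ∨
      0 ≤ classValue φ e p := by
    intro p
    rcases lt_or_ge (classValue φ e p) 0 with h | h
    · have : classValue φ e p ∈ primeClasses φ e ∩ Set.Iio 0 := ⟨⟨p, rfl⟩, h⟩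
      rw [hneg] at this
      rcases this with h | h
      exacts [Or.inl h, Or.inr (Or.inl h)]
    · exact Or.inr (Or.inr h)
  rcases (show d = 1 ∨ 2 ≤ d by omega) with hd1 | hd2
  · have hHF := isHalfFactorial_of_eq_one hdiv e hST.1 hw hd1
    exact Or.inl ⟨Or.inl hHF, fun h => h.2 (hHF.hasAcceptedElasticity hdiv e)⟩
  by_cases hfin : (primeClasses φ e).Finite
  · refine Or.inl ⟨Or.inr hfin, fun h => ?_⟩
    obtain ⟨B, hB⟩ := hfin.bddAbove
    have hB' : ∀ p, classValue φ e p ≤ B.toNat := fun p =>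
      (hB ⟨p, rfl⟩).trans (Int.self_le_toNat B)
    -- Bounded classes make `C` independent of `a`, so the strict inequality survives the supremum.
    have hle : elasticity H ≤ elasticityBound d (B.toNat + d) := iSup_le fun a =>
      elementElasticity_le hdiv e hw hd2 fun U _ hU => hU.negOneCount_le hw hd hB'
    exact (hle.trans_lt (elasticityBound_lt hd2 _)).ne h.1
  · obtain ⟨o, ho⟩ := hpos
    obtain ⟨n, hn⟩ : (-(d : ℤ)) ∈ primeClasses φ e :=
      (hneg.ge (Set.mem_insert _ _)).1
    obtain ⟨m, hm⟩ : (-1 : ℤ) ∈ primeClasses φ e :=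
      (hneg.ge (Set.mem_insert_of_mem _ rfl)).1
    have hinf : ∀ B : ℕ, ∃ g, (B : ℤ) < classValue φ e g := by
      by_contra! h
      obtain ⟨B, hB⟩ := h
      refine hfin ((Set.finite_Icc (-(d : ℤ)) B).subset ?_)
      rintro _ ⟨p, rfl⟩
      have h1 := hw p
      exact ⟨show -(d : ℤ) ≤ classValue φ e p by omega, hB p⟩
    -- Here `C` is the number of terms `-1` in the whole sequence of `a`: strict for each element,
    -- but not uniform.
    have hlt : ∀ a : H, elementElasticity a < d := fun a =>
      (elementElasticity_le hdiv e hw hd2 fun U hU _ =>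
        Multiset.countP_le_of_le _ hU).trans_lt (elasticityBound_lt hd2 _)
    have heq : elasticity H = d := le_antisymm (iSup_le fun a => (hlt a).le)
      (le_elasticity hdiv e hd ho hm hn hinf)
    refine Or.inr ⟨⟨heq, fun ⟨a, ha⟩ => (hlt a).ne (ha.trans heq)⟩, ?_⟩
    rintro (h | h)
    · have h1 := h.elasticity_le
      rw [heq] at h1
      have : d ≤ 1 := by exact_mod_cast h1
      omega
    · exact hfin h
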